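/- Let $k$ be a field and let $H\subseteq\mathbb{N}$ be a numerical semigroup with multiplicity $a=\min(H\setminus\{0\})$ and embedding dimension (number of minimal generators) $n\ge 3$. Let $k[H]=\bigoplus_{x\in H}k\,t^x\subseteq k[t]$, with graded maximal ideal $\mathfrak m=(t^x : 0<x\in H)$. Put $\ell=a-n+1$ and assume $\ell\ge 2$. Suppose that the Artinian local ring $k[H]/(t^{a})$ is stretched, i.e. the square of its maximal ideal is zero or principal, and that the set $\operatorname{PF}(H)=\{x\in\mathbb{Z}\setminus H : x+y\in H \text{ for all } 0<y\in H\}$ of pseudo-Frobenius numbers of $H$ is $$\operatorname{PF}(H)=\{h+\alpha,\,h+2\alpha,\ldots,h+(n-1)\alpha\}$$ for some integers $h\ge 0$ and $\alpha>0$. Suppose further (the case $j=1$) that $b=\frac{h+\alpha+a}{\ell}$ is an integer and that $$\{a,\ b\}\cup\{h+i\alpha+a : 2\le i\le n-1\}$$ is the minimal system of generators of $H$. Then there is an integer $h_1\ge 0$ (clearly unique, since $a>0$) with $h=h_1a+(\ell-1)b$, and the tangent cone $\operatorname{gr}(k[H])=\bigoplus_{i\ge 0}\mathfrak m^i/\mathfrak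 m^{i+1}$ is Cohen–Macaulay if and only if $h_1+1\ge\ell$. -/

import Mathlib

open Polynomial

/-- A numerical semigroup: a submonoid of `ℕ` with finite complement
(equivalently, one generated by integers with greatest common divisor `1`). -/
def IsNumericalSemigroup (H : AddSubmonoid ℕ) : Prop :=
  ((H : Set ℕ)ᶜ).Finite

/-- The minimal system of generators of `H`: the nonzero elements of `H` that are not the sum of
two nonzero elements of `H`. -/
def minimalGenerators (H : AddSubmonoid ℕ) : Set ℕ :=
  {x | x ∈ H ∧ x ≠ 0 ∧ ∀ y ∈ H, ∀ z ∈ H, y + z = x → y = 0 ∨ z = 0}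

/-- The embedding dimension: the number of minimal generators. -/
noncomputable def embeddingDimension (H : AddSubmonoid ℕ) : ℕ :=
  (minimalGenerators H).ncard

/-- `a` is the multiplicity of `H`, i.e. `a = min (H \ {0})`. -/
def IsMultiplicity (H : AddSubmonoid ℕ) (a : ℕ) : Prop :=
  IsLeast {x | x ∈ H ∧ x ≠ 0} a

/-- The image of `H` in `ℤ`. -/
def intElements (H : AddSubmonoid ℕ) : Set ℤ :=
  (fun x : ℕ => (x : ℤ)) '' (H : Set ℕ)

/-- The set of pseudo-Frobenius numbers of `H`. -/
def pseudoFrobenius (H : AddSubmonoid ℕ) : Set ℤ :=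
  {x | x ∉ intElements H ∧ ∀ y ∈ H, 0 < y → x + (y : ℤ) ∈ intElements H}

/-- The numerical semigroup ring `k[H] ⊆ k[t]`: the polynomials all of whose exponents lie in `H`,
that is, the `k`-span of the `t ^ x` with `x ∈ H`. -/
def semigroupRing (k : Type*) [Field k] (H : AddSubmonoid ℕ) : Subalgebra k k[X] where
  carrier := {f | ∀ i, f.coeff i ≠ 0 → i ∈ H}
  mul_mem' := by
    intro f g hf hg i hi
    rw [coeff_mul] at hi
    obtain ⟨⟨p, q⟩, hpq, hne⟩ := Finset.exists_ne_zero_of_sum_ne_zero hi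
    rw [← Finset.HasAntidiagonal.mem_antidiagonal.mp hpq]
    exact H.add_mem (hf p (left_ne_zero_of_mul hne)) (hg q (right_ne_zero_of_mul hne))
  add_mem' := by
    intro f g hf hg i hi
    by_cases h : f.coeff i = 0
    · refine hg i fun h' => hi ?_
      rw [coeff_add, h, h', add_zero]
    · exact hf i h
  algebraMap_mem' := by
    intro r i hi
    rw [Polynomial.algebraMap_apply, coeff_C] at hi
    have h0 : i = 0 := by
      by_contra h
      simp [h] at hi
    rw [h0]
    exact H.zero_mem

/-- The monomial `t ^ x` as an element of `k[H]`, for `x ∈ H`. -/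
noncomputable def semigroupMonomial (k : Type*) [Field k] (H : AddSubmonoid ℕ) (x : ℕ)
    (hx : x ∈ H) : semigroupRing k H :=
  ⟨X ^ x, by
    intro i hi
    rw [coeff_X_pow] at hi
    have h0 : i = x := by
      by_contra h
      simp [h] at hi
    rwa [h0]⟩

/-- The graded maximal ideal of `k[H]`: the elements with zero constant term. -/
noncomputable def semigroupMaximalIdeal (k : Type*) [Field k] (H : AddSubmonoid ℕ) :
    Ideal (semigroupRing k H) :=
  RingHom.ker ((constantCoeff : k[X] →+* k).comp
    ((semigroupRing k H).val : semigroupRing k H →+* k[X]))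

/-- A stretched Artinian local ring: an Artinian local ring with maximal ideal `m` such that
`m ^ 2` is zero or principal. -/
def IsStretchedArtinianLocal (A : Type*) [CommRing A] : Prop :=
  IsArtinianRing A ∧ ∃ _ : IsLocalRing A,
    IsLocalRing.maximalIdeal A ^ 2 = ⊥ ∨ (IsLocalRing.maximalIdeal A ^ 2).IsPrincipal

/-- The ideal `⨁ᵢ I ^ (i + 1) tⁱ` of the Rees algebra `⨁ᵢ I ^ i tⁱ`. -/
def reesShiftIdeal {R : Type*} [CommRing R] (I : Ideal R) : Ideal (reesAlgebra I) where
  carrier := {f | ∀ i, (f : R[X]).coeff i ∈ I ^ (i + 1)}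
  add_mem' := by
    intro f g hf hg i
    have h := Ideal.add_mem _ (hf i) (hg i)
    simpa using h
  zero_mem' := by
    intro i
    simp
  smul_mem' := by
    intro c f hf i
    change ((c : R[X]) * (f : R[X])).coeff i ∈ I ^ (i + 1)
    rw [coeff_mul]
    refine Ideal.sum_mem _ ?_
    rintro ⟨p, q⟩ hpq
    rw [← Finset.HasAntidiagonal.mem_antidiagonal.mp hpq, add_assoc, pow_add]
    exact Ideal.mul_mem_mul (c.2 p) (hf q)

/-- The associated graded ring `gr_I(R) = ⨁ᵢ I ^ i / I ^ (i + 1)`, realised as the quotient of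
`⨁ᵢ I ^ i tⁱ` by `⨁ᵢ I ^ (i + 1) tⁱ`. -/
abbrev AssociatedGradedRing {R : Type*} [CommRing R] (I : Ideal R) : Type _ :=
  reesAlgebra I ⧸ reesShiftIdeal I

/-- A Cohen-Macaulay local ring: a Noetherian local ring admitting a regular sequence in its
maximal ideal whose length is the Krull dimension. -/
def IsCohenMacaulayLocal (R : Type*) [CommRing R] [IsLocalRing R] : Prop :=
  IsNoetherianRing R ∧ ∃ rs : List R,
    (∀ r ∈ rs, r ∈ IsLocalRing.maximalIdeal R) ∧
    RingTheory.Sequence.IsRegular R rs ∧ (rs.length : WithBot ℕ∞) = ringKrullDim R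

/-- A Cohen-Macaulay ring: a Noetherian ring whose localizations at maximal ideals are
Cohen-Macaulay local rings. -/
def IsCohenMacaulay (R : Type*) [CommRing R] : Prop :=
  IsNoetherianRing R ∧ ∀ (p : Ideal R) [p.IsMaximal],
    IsCohenMacaulayLocal (Localization.AtPrime p)

/-- The tangent cone `gr(k[H])` with respect to the graded maximal ideal of `k[H]`. -/
abbrev TangentCone (k : Type*) [Field k] (H : AddSubmonoid ℕ) : Type _ :=
  AssociatedGradedRing (semigroupMaximalIdeal k H)

/-! With `r = n - 2`, adding `a` to the pseudo-Frobenius numbers gives the maximal Apéry elements `ℓ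
* b + i * α`, `0 ≤ i ≤ r`. Stripping generators from Apéry elements shows that the Apéry set
consists of these and the `j * b`, `j ≤ ℓ` (`apery_cases`). Comparing residues forces `b = α + q *
a` with `q ≥ 1`, and `h₁ = q - 1`. Everything turns on the relation `(ℓ + 1) * b = (ℓ * b + α) + q *
a`, with `ℓ + 1` summands on the left and `q + 1` on the right.

If `ℓ ≤ q`, rewriting towards "Apéry element plus multiple of `a`" never loses summands
(`HasLevel`). So subtracting `a` within `H` lowers the order by at most one, and the initial form of
`t ^ a` is a nonzerodivisor. If `q < ℓ`, the nonzero class of `t ^ (ℓ * b + α)` in `𝔪 / 𝔪 ^ 2` is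
killed by the `q`-th power of that form.

The tangent cone maps onto `k[X]` with nilpotent kernel, the form of `t ^ a` going to `X`. Hence all
its maximal ideals have height one. In the first case each contains a nonzerodivisor
(`isCohenMacaulay_of_surjective`); in the second, the ideal over `(X)` lies in the radical of the
annihilator of a nonzero element (`eq_zero_of_isCohenMacaulay`). -/

/-! ### The order filtration of `H` and its minimal generators -/

/-- The elements of `H` that are sums of at least `m` nonzero elements of `H`. -/
def orderSet (H : AddSubmonoid ℕ) : ℕ → Set ℕ
  | 0 => H
  | m + 1 => {x | ∃ y ∈ orderSet H m, ∃ z ∈ H, z ≠ 0 ∧ y + z = x}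

theorem add_mem_orderSet_succ {H : AddSubmonoid ℕ} {m x z : ℕ} (hx : x ∈ orderSet H m)
    (hz : z ∈ H) (hz0 : z ≠ 0) : x + z ∈ orderSet H (m + 1) :=
  ⟨x, hx, z, hz, hz0, rfl⟩

theorem add_mem_orderSet {H : AddSubmonoid ℕ} {m x z : ℕ} (hx : x ∈ orderSet H m)
    (hz : z ∈ H) : x + z ∈ orderSet H m := by
  induction m generalizing x with
  | zero => exact H.add_mem hx hz
  | succ m ih =>
    obtain ⟨y, hy, z', hz', h0, rfl⟩ := hx
    rw [add_right_comm]
    exact add_mem_orderSet_succ (ih hy) hz' h0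

theorem orderSet_succ_subset (H : AddSubmonoid ℕ) (m : ℕ) :
    orderSet H (m + 1) ⊆ orderSet H m := by
  rintro _ ⟨y, hy, z, hz, -, rfl⟩
  exact add_mem_orderSet hy hz

theorem orderSet_antitone (H : AddSubmonoid ℕ) : Antitone (orderSet H) :=
  antitone_nat_of_succ_le (orderSet_succ_subset H)

theorem orderSet_subset (H : AddSubmonoid ℕ) (m : ℕ) : orderSet H m ⊆ H :=
  orderSet_antitone H (Nat.zero_le m)

theorem add_mul_mem_orderSet {H : AddSubmonoid ℕ} {m x z : ℕ} (hx : x ∈ orderSet H m)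
    (hz : z ∈ H) (hz0 : z ≠ 0) (j : ℕ) : x + j * z ∈ orderSet H (m + j) := by
  induction j with
  | zero => simpa using hx
  | succ j ih =>
    have := add_mem_orderSet_succ ih hz hz0
    rwa [add_assoc x, ← Nat.succ_mul] at this

theorem mul_mem_orderSet {H : AddSubmonoid ℕ} {z : ℕ} (hz : z ∈ H) (hz0 : z ≠ 0) (j : ℕ) :
    j * z ∈ orderSet H j := by
  simpa using add_mul_mem_orderSet (m := 0) (x := 0) H.zero_mem hz hz0 j

theorem add_mem_orderSet_add {H : AddSubmonoid ℕ} {i j x y : ℕ} (hx : x ∈ orderSet H i)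
    (hy : y ∈ orderSet H j) : x + y ∈ orderSet H (i + j) := by
  induction j generalizing y with
  | zero => exact add_mem_orderSet hx hy
  | succ j ih =>
    obtain ⟨y', hy', z, hz, h0, rfl⟩ := hy
    rw [← add_assoc x]
    exact add_mem_orderSet_succ (m := i + j) (ih hy') hz h0

theorem mul_le_of_mem_orderSet {H : AddSubmonoid ℕ} {a : ℕ} (ha : IsMultiplicity H a) {m x : ℕ}
    (hx : x ∈ orderSet H m) : a * m ≤ x := by
  induction m generalizing x with
  | zero => simp
  | succ m ih =>
    obtain ⟨y, hy, z, hz, h0, rfl⟩ := hx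
    have h1 := ih hy
    have h2 := ha.2 ⟨hz, h0⟩
    rw [mul_add, mul_one]
    omega

theorem not_mem_orderSet_two {H : AddSubmonoid ℕ} {x : ℕ} (hx : x ∈ minimalGenerators H) :
    x ∉ orderSet H 2 := by
  rintro ⟨y, ⟨u, hu, v, hv, hv0, rfl⟩, z, hz, hz0, h⟩
  have := hx.2.2 _ (H.add_mem hu hv) z hz h
  omega

theorem exists_minimalGenerators_add {H : AddSubmonoid ℕ} (x : ℕ) (hx : x ∈ H) (h0 : x ≠ 0) :
    ∃ y ∈ minimalGenerators H, ∃ z ∈ H, y + z = x := by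
  induction x using Nat.strong_induction_on with
  | _ x ih =>
    by_cases hm : x ∈ minimalGenerators H
    · exact ⟨x, hm, 0, H.zero_mem, rfl⟩
    · have : ∃ y ∈ H, ∃ z ∈ H, y + z = x ∧ y ≠ 0 ∧ z ≠ 0 := by
        by_contra! hcon
        exact hm ⟨hx, h0, fun y hy z hz hyz => by
          by_contra! hc
          exact hc.2 (hcon y hy z hz hyz hc.1)⟩
      obtain ⟨y, hy, z, hz, rfl, hy0, hz0⟩ := this
      obtain ⟨u, hu, v, hv, rfl⟩ := ih y (by omega) hy hy0
      exact ⟨u, hu, v + z, H.add_mem hv hz, by omega⟩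

/-- The starting point `x` is arbitrary so that the induction can begin at an element whose order or
level is already known. -/
theorem induction_minimalGenerators {H : AddSubmonoid ℕ} {P : ℕ → Prop} {x z : ℕ} (hx : P x)
    (hP : ∀ u, P u → ∀ g ∈ minimalGenerators H, P (u + g)) (hz : z ∈ H) : P (x + z) := by
  induction z using Nat.strong_induction_on generalizing x with
  | _ z ih =>
    rcases eq_or_ne z 0 with rfl | h0
    · exact hx
    · obtain ⟨g, hg, v, hv, rfl⟩ := exists_minimalGenerators_add z hz h0
      rw [← add_assoc]
      have := hg.2.1
      exact ih v (by omega) (hP x hx g hg) hv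

/-! ### Apéry sets -/

/-- The elements of the Apéry set of `H` with respect to `a`. -/
def IsApery (H : AddSubmonoid ℕ) (a w : ℕ) : Prop :=
  w ∈ H ∧ ∀ z ∈ H, z + a ≠ w

theorem IsApery.of_add {H : AddSubmonoid ℕ} {a y z : ℕ} (h : IsApery H a (y + z)) (hy : y ∈ H)
    (hz : z ∈ H) : IsApery H a z :=
  ⟨hz, fun u hu hua => h.2 (y + u) (H.add_mem hy hu) (by omega)⟩

theorem IsApery.le_of_modEq {H : AddSubmonoid ℕ} {a w x : ℕ} (ha : a ∈ H) (hw : IsApery H a w)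
    (hx : x ∈ H) (h : w ≡ x [MOD a]) : w ≤ x := by
  by_contra! hlt
  obtain ⟨k, hk⟩ := (Nat.modEq_iff_dvd' hlt.le).1 h.symm
  cases k with
  | zero => simp at hk; omega
  | succ k =>
    refine hw.2 (x + k * a) (H.add_mem hx ?_) ?_
    · simpa using H.nsmul_mem ha k
    · rw [mul_add, mul_one, mul_comm] at hk
      omega

theorem IsApery.eq_of_modEq {H : AddSubmonoid ℕ} {a w w' : ℕ} (ha : a ∈ H) (hw : IsApery H a w)
    (hw' : IsApery H a w') (h : w ≡ w' [MOD a]) : w = w' :=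
  le_antisymm (hw.le_of_modEq ha hw'.1 h) (hw'.le_of_modEq ha hw.1 h.symm)

theorem exists_isApery_modEq {H : AddSubmonoid ℕ} {a : ℕ} (ha0 : a ≠ 0) (x : ℕ) (hx : x ∈ H) :
    ∃ w, IsApery H a w ∧ w ≡ x [MOD a] := by
  induction x using Nat.strong_induction_on with
  | _ x ih =>
    by_cases h : ∃ z ∈ H, z + a = x
    · obtain ⟨z, hz, rfl⟩ := h
      obtain ⟨w, hw, hwz⟩ := ih z (by omega) hz
      exact ⟨w, hw, hwz.trans (by simp [Nat.ModEq])⟩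
    · push Not at h
      exact ⟨x, ⟨hx, h⟩, rfl⟩

/-! ### The Apéry set in the arithmetic case, and the shape of `b` -/

/-- `H` is generated by `a`, `b` and the arithmetic progression `ℓ * b + i * α` for `1 ≤ i ≤ r`,
where `a = ℓ + r + 1`, and the maximal elements of the Apéry set of `H` with respect to `a` are the
`ℓ * b + i * α` for `0 ≤ i ≤ r`. -/
structure IsArithmeticStretched (H : AddSubmonoid ℕ) (a b ℓ α r : ℕ) : Prop where
  a_mem : a ∈ H
  b_mem : b ∈ H
  a_ne_zero : a ≠ 0
  b_ne_zero : b ≠ 0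
  α_pos : 0 < α
  two_le : 2 ≤ ℓ
  r_pos : 1 ≤ r
  a_eq : a = ℓ + r + 1
  gen : ∀ x ∈ minimalGenerators H, x = a ∨ x = b ∨ ∃ i, 1 ≤ i ∧ i ≤ r ∧ x = ℓ * b + i * α
  min_gen : ∀ i, 1 ≤ i → i ≤ r → ℓ * b + i * α ∈ minimalGenerators H
  apery : ∀ i ≤ r, IsApery H a (ℓ * b + i * α)
  maximal : ∀ i ≤ r, ∀ y ∈ H, y ≠ 0 → ¬ IsApery H a (ℓ * b + i * α + y)

namespace IsArithmeticStretched

variable {H : AddSubmonoid ℕ} {a b ℓ α r : ℕ}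

theorem mul_b_mem (S : IsArithmeticStretched H a b ℓ α r) (j : ℕ) : j * b ∈ H := by
  simpa using H.nsmul_mem S.b_mem j

theorem apery_mul (S : IsArithmeticStretched H a b ℓ α r) {j : ℕ} (hj : j ≤ ℓ) :
    IsApery H a (j * b) := by
  have h := S.apery 0 (Nat.zero_le _)
  obtain ⟨i, rfl⟩ := Nat.exists_eq_add_of_le' hj
  rw [zero_mul, add_zero, add_mul] at h
  exact h.of_add (S.mul_b_mem i) (S.mul_b_mem j)

/-- Remove a generator from `w`: it is not `a`, and if it lies in the progression nothing remains,
by maximality. If it is `b`, induction applies to the remainder, which cannot be a maximal element.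
-/
theorem apery_cases (S : IsArithmeticStretched H a b ℓ α r) (w : ℕ) (hw : IsApery H a w) :
    (∃ j ≤ ℓ, w = j * b) ∨ ∃ i, 1 ≤ i ∧ i ≤ r ∧ w = ℓ * b + i * α := by
  induction w using Nat.strong_induction_on with
  | _ w ih =>
    rcases eq_or_ne w 0 with rfl | h0
    · exact .inl ⟨0, Nat.zero_le _, by simp⟩
    obtain ⟨y, hy, z, hz, rfl⟩ := exists_minimalGenerators_add w hw.1 h0
    have hzA := hw.of_add hy.1 hz
    have hmax : ∀ i ≤ r, z ≠ ℓ * b + i * α := by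
      rintro i hi rfl
      exact S.maximal i hi y hy.1 hy.2.1 (by rwa [add_comm])
    rcases S.gen y hy with rfl | rfl | ⟨i, hi1, hi, rfl⟩
    · exact absurd (add_comm _ _) (hw.2 z hz)
    · rcases ih z (by have := S.b_ne_zero; omega) hzA with ⟨j, hj, rfl⟩ | ⟨i, -, hi, h⟩
      · rcases hj.lt_or_eq with hj | rfl
        · exact .inl ⟨j + 1, hj, by ring⟩
        · exact absurd (by simp) (hmax 0 (Nat.zero_le _))
      · exact absurd h (hmax i hi)
    · rcases eq_or_ne z 0 with rfl | hz0
      · exact .inr ⟨i, hi1, hi, rfl⟩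
      · exact absurd hw (S.maximal i hi z hz hz0)

theorem modEq (S : IsArithmeticStretched H a b ℓ α r) : α ≡ b [MOD a] := by
  have h1 := S.apery 1 S.r_pos
  -- Adding `(a - 1) * b` is subtracting `b` modulo `a`, so `w` represents the class of `ℓ * b + α -
  -- b`. The claim amounts to `w = ℓ * b`.
  obtain ⟨w, hw, hmod⟩ := exists_isApery_modEq S.a_ne_zero _
    (H.add_mem h1.1 (S.mul_b_mem (a - 1)))
  have hab : (a - 1) * b + b = a * b := by
    rw [← Nat.succ_mul, Nat.succ_eq_add_one, Nat.sub_add_cancel]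
    have := S.a_ne_zero
    omega
  have hmod' : w + b ≡ ℓ * b + 1 * α [MOD a] := by
    refine (hmod.add_right b).trans ?_
    rw [add_assoc, hab]
    simp [Nat.ModEq]
  have hα := S.α_pos
  have hb := S.b_ne_zero
  have hℓ := S.two_le
  rcases S.apery_cases w hw with ⟨j, hj, rfl⟩ | ⟨i, hi1, hi, rfl⟩
  · rcases hj.lt_or_eq with hj | rfl
    · rw [← Nat.succ_mul] at hmod'
      have := (S.apery_mul (j := j + 1) hj).eq_of_modEq S.a_mem h1 hmod'
      have : (j + 1) * b ≤ ℓ * b := Nat.mul_le_mul_right _ hj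
      omega
    · simpa using (Nat.ModEq.add_left_cancel' _ hmod').symm
  · rw [add_assoc] at hmod'
    have h2 := Nat.ModEq.add_left_cancel' _ hmod'
    obtain ⟨i, rfl⟩ := Nat.exists_eq_add_of_le' hi1
    have h3 : i * α + b ≡ 0 [MOD a] := by
      refine Nat.ModEq.add_left_cancel' (1 * α) ?_
      rw [add_zero, ← add_assoc, ← add_mul, add_comm 1 i]
      exact h2
    -- Two Apéry elements in one class coincide, but these two differ in size.
    have h4 : ℓ * b + i * α ≡ (ℓ - 1) * b [MOD a] := by
      have := h3.add_left ((ℓ - 1) * b)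
      have e : (ℓ - 1) * b + (i * α + b) = ℓ * b + i * α := by
        obtain ⟨ℓ, rfl⟩ := Nat.exists_eq_add_of_le' hℓ
        simp only [show ℓ + 2 - 1 = ℓ + 1 from rfl]
        ring
      rwa [e, add_zero] at this
    have h5 := (S.apery i (by omega)).eq_of_modEq S.a_mem (S.apery_mul (by omega)) h4
    have : (ℓ - 1) * b < ℓ * b := Nat.mul_lt_mul_of_pos_right (by omega) (by omega)
    omega

/-- The Apéry element `ℓ * b + α` is the least in its class, which contains `(ℓ + 1) * b`; hence `α
≤ b`. Equality would make the generator `ℓ * b + α` decomposable. -/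
theorem exists_b_eq (S : IsArithmeticStretched H a b ℓ α r) :
    ∃ q, 1 ≤ q ∧ b = α + q * a := by
  have h1 := S.apery 1 S.r_pos
  have hle := h1.le_of_modEq S.a_mem (S.mul_b_mem (ℓ + 1))
    (by rw [add_mul]; exact Nat.ModEq.add_left _ (by simpa using S.modEq))
  rw [add_mul, one_mul, one_mul] at hle
  have hle' : α ≤ b := by omega
  obtain ⟨q, hq⟩ := (Nat.modEq_iff_dvd' hle').1 S.modEq
  refine ⟨q, Nat.one_le_iff_ne_zero.2 ?_, by rw [mul_comm]; omega⟩
  rintro rfl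
  have hb : b = α := by omega
  have hα := S.α_pos
  have := (S.min_gen 1 le_rfl S.r_pos).2.2 _ (S.mul_b_mem ℓ) b S.b_mem (by rw [hb]; simp)
  have hb' := S.b_ne_zero
  have hℓ := S.two_le
  rcases this with h | h
  · rcases mul_eq_zero.1 h with h | h <;> omega
  · exact hb' h

/-! ### Counting summands in standard expressions when `ℓ ≤ q` -/

/-- `x` has a standard expression as an Apéry element plus a multiple of `a` with at least `m`
summands. -/
def HasLevel (a b ℓ α r m x : ℕ) : Prop :=
  (∃ i j, i ≤ ℓ ∧ x = i * b + j * a ∧ m ≤ i + j) ∨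
    ∃ i j, 1 ≤ i ∧ i ≤ r ∧ x = ℓ * b + i * α + j * a ∧ m ≤ 1 + j

theorem HasLevel.mono {m m' x : ℕ} (h : HasLevel a b ℓ α r m x) (hm : m' ≤ m) :
    HasLevel a b ℓ α r m' x := by
  rcases h with ⟨i, j, hi, hx, hle⟩ | ⟨i, j, h1, hi, hx, hle⟩
  · exact .inl ⟨i, j, hi, hx, by omega⟩
  · exact .inr ⟨i, j, h1, hi, hx, by omega⟩

theorem HasLevel.add_a {m x : ℕ} (h : HasLevel a b ℓ α r m x) (t : ℕ) :
    HasLevel a b ℓ α r (m + t) (x + t * a) := by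
  rcases h with ⟨i, j, hi, rfl, hle⟩ | ⟨i, j, h1, hi, rfl, hle⟩
  · exact .inl ⟨i, j + t, hi, by ring, by omega⟩
  · exact .inr ⟨i, j + t, h1, hi, by ring, by omega⟩

theorem hasLevel_generator (hℓ : 2 ≤ ℓ) {i : ℕ} (hi : i ≤ r) :
    HasLevel a b ℓ α r 1 (ℓ * b + i * α) := by
  rcases Nat.eq_zero_or_pos i with rfl | h1
  · exact .inl ⟨ℓ, 0, le_rfl, by simp, by omega⟩
  · exact .inr ⟨i, 0, h1, hi, by simp, by omega⟩

theorem HasLevel.add_b {q m x : ℕ} (ha : a = ℓ + r + 1) (hr : 1 ≤ r) (hq : ℓ ≤ q) (hℓ : 2 ≤ ℓ)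
    (hb : b = α + q * a) (h : HasLevel a b ℓ α r m x) :
    HasLevel a b ℓ α r (m + 1) (x + b) := by
  rcases h with ⟨i, j, hi, rfl, hle⟩ | ⟨i, j, h1, hi, rfl, hle⟩
  · rcases hi.lt_or_eq with hi | rfl
    · exact .inl ⟨i + 1, j, hi, by ring, by omega⟩
    -- Here `(ℓ + 1) * b` becomes `(ℓ * b + α) + q * a`. This is where the full strength of `ℓ ≤ q`
    -- is needed; the other cases only use that `q` is positive.
    · refine .inr ⟨1, j + q, le_rfl, hr, ?_, by omega⟩
      nth_rw 2 [hb]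
      ring
  · rcases hi.lt_or_eq with hi | rfl
    · refine .inr ⟨i + 1, j + q, by omega, hi, ?_, by omega⟩
      nth_rw 2 [hb]
      ring
    -- The end of the progression wraps around to a multiple of `a`: `(ℓ + 1) * b + r * α = a * α +
    -- q * (ℓ + 1) * a`, because `a = ℓ + r + 1`.
    · refine .inl ⟨0, j + (α + q * (ℓ + 1)), by omega, ?_, ?_⟩
      · subst hb ha
        ring
      · have : 1 * 2 ≤ q * (ℓ + 1) := Nat.mul_le_mul (by omega) (by omega)
        omega

theorem HasLevel.add_mul_b {q m x : ℕ} (ha : a = ℓ + r + 1) (hr : 1 ≤ r) (hq : ℓ ≤ q) (hℓ : 2 ≤ ℓ)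
    (hb : b = α + q * a) (h : HasLevel a b ℓ α r m x) (t : ℕ) :
    HasLevel a b ℓ α r (m + t) (x + t * b) := by
  induction t with
  | zero => simpa using h
  | succ t ih =>
    have := ih.add_b ha hr hq hℓ hb
    rwa [add_assoc x, ← Nat.succ_mul] at this

theorem HasLevel.add_generator {q m x : ℕ} (ha : a = ℓ + r + 1) (hr : 1 ≤ r) (hq : ℓ ≤ q)
    (hℓ : 2 ≤ ℓ) (hb : b = α + q * a) (h : HasLevel a b ℓ α r m x) {i : ℕ} (hi : i ≤ r) :
    HasLevel a b ℓ α r (m + 1) (x + (ℓ * b + i * α)) := by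
  have hq1 : 1 * 1 ≤ q * ℓ := Nat.mul_le_mul (by omega) (by omega)
  rcases h with ⟨i', j, -, rfl, hle⟩ | ⟨i', j, h1, hi', rfl, hle⟩
  · have := ((hasLevel_generator (a := a) (b := b) (α := α) hℓ hi).add_mul_b ha hr hq hℓ hb
      i').add_a j
    convert this.mono (m' := m + 1) (by omega) using 1
    ring
  · rcases le_or_gt (i + i') r with hs | hs
    · have := ((hasLevel_generator (a := a) (b := b) (α := α) hℓ hs).add_mul_b ha hr hq hℓ hb
        ℓ).add_a j
      convert this.mono (m' := m + 1) (by omega) using 1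
      ring
    -- With `i + i' = r + s + 1`, expanding one `ℓ * b` as `ℓ * α + q * ℓ * a` collects `ℓ + r + 1 =
    -- a` copies of `α`, leaving `ℓ * b + s * α`.
    · obtain ⟨s, hs⟩ := Nat.exists_eq_add_of_lt hs
      have := (hasLevel_generator (a := a) (b := b) (α := α) hℓ (show s ≤ r by omega)).add_a
        (j + (α + q * ℓ))
      convert this.mono (m' := m + 1) (by omega) using 1
      have e : ℓ * b + i' * α + j * a + (ℓ * b + i * α) = ℓ * b + ℓ * b + (i + i') * α + j * a := by
        ring
      rw [e, hs]
      nth_rw 2 [hb]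
      subst ha
      ring

theorem hasLevel_of_mem_orderSet (S : IsArithmeticStretched H a b ℓ α r) {q : ℕ}
    (hb : b = α + q * a) (hq : ℓ ≤ q) {m x : ℕ} (hx : x ∈ orderSet H m) :
    HasLevel a b ℓ α r m x := by
  have step : ∀ m u, HasLevel a b ℓ α r m u → ∀ g ∈ minimalGenerators H,
      HasLevel a b ℓ α r (m + 1) (u + g) := by
    intro m u hu g hg
    rcases S.gen g hg with rfl | rfl | ⟨i, -, hi, rfl⟩
    · simpa using hu.add_a 1
    · exact hu.add_b S.a_eq S.r_pos hq S.two_le hb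
    · exact hu.add_generator S.a_eq S.r_pos hq S.two_le hb hi
  have step' : ∀ m u, HasLevel a b ℓ α r m u → ∀ g ∈ H, HasLevel a b ℓ α r m (u + g) :=
    fun m u hu g hg => induction_minimalGenerators hu
      (fun u hu g hg => (step m u hu g hg).mono (Nat.le_succ m)) hg
  induction m generalizing x with
  | zero =>
    have := step' 0 0 (.inl ⟨0, 0, by omega, by simp, le_rfl⟩) x hx
    rwa [zero_add] at this
  | succ m ih =>
    obtain ⟨y, hy, z, hz, hz0, rfl⟩ := hx
    obtain ⟨g, hg, v, hv, rfl⟩ := exists_minimalGenerators_add z hz hz0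
    rw [← add_assoc]
    exact step' _ _ (step _ _ (ih hy) g hg) v hv

/-- The standard expression of `x + a` contains a summand `a`, since otherwise `x + a` would be an
Apéry element; delete it. -/
theorem mem_orderSet_of_add_mem (S : IsArithmeticStretched H a b ℓ α r) {q : ℕ}
    (hb : b = α + q * a) (hq : ℓ ≤ q) {m x : ℕ} (hxH : x ∈ H) (hx : x + a ∈ orderSet H (m + 1)) :
    x ∈ orderSet H m := by
  rcases S.hasLevel_of_mem_orderSet hb hq hx with ⟨i, j, hi, hxe, hle⟩ | ⟨i, j, h1, hi, hxe, hle⟩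
  · cases j with
    | zero => exact absurd (by simpa using hxe) ((S.apery_mul hi).2 x hxH)
    | succ j =>
      have : x = i * b + j * a := by rw [add_mul] at hxe; omega
      rw [this]
      exact orderSet_antitone H (show m ≤ i + j by omega)
        (add_mul_mem_orderSet (mul_mem_orderSet S.b_mem S.b_ne_zero i) S.a_mem S.a_ne_zero j)
  · cases j with
    | zero => exact absurd (by simpa using hxe) ((S.apery i hi).2 x hxH)
    | succ j =>
      have : x = ℓ * b + i * α + j * a := by rw [add_mul j] at hxe; omega
      rw [this]
      have hg := S.min_gen i h1 hi
      have := add_mul_mem_orderSet (mul_mem_orderSet hg.1 hg.2.1 1) S.a_mem S.a_ne_zero j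
      rw [one_mul] at this
      exact orderSet_antitone H (show m ≤ 1 + j by omega) this

end IsArithmeticStretched

/-! ### From pseudo-Frobenius numbers to the Apéry set -/

/-- Adding `a` turns pseudo-Frobenius numbers into maximal Apéry elements. Since `ℓ * b = h + α +
a`, the index `i` here is one less than in `h + i * α`. -/
theorem isArithmeticStretched_of_pseudoFrobenius {H : AddSubmonoid ℕ}
    {n a ℓ h α b : ℕ} (hn : 3 ≤ n) (hℓ : 2 ≤ ℓ) (hα : 0 < α)
    (ha : IsMultiplicity H a) (haℓ : a + 1 = ℓ + n)
    (hPF : pseudoFrobenius H =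
      {x : ℤ | ∃ i : ℕ, 1 ≤ i ∧ i ≤ n - 1 ∧ x = (h : ℤ) + (i : ℤ) * (α : ℤ)})
    (hb : ℓ * b = h + α + a)
    (hgen : minimalGenerators H =
      {a, b} ∪ {x : ℕ | ∃ i : ℕ, 2 ≤ i ∧ i ≤ n - 1 ∧ x = h + i * α + a}) :
    IsArithmeticStretched H a b ℓ α (n - 2) := by
  have hbg : b ∈ minimalGenerators H := by rw [hgen]; simp
  have key : ∀ i, ℓ * b + i * α = h + (i + 1) * α + a := by
    intro i
    rw [hb]
    ring
  have hmem : ∀ i ≤ n - 2, ((h : ℤ) + ((i + 1 : ℕ) : ℤ) * (α : ℤ)) ∈ pseudoFrobenius H := by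
    intro i hi
    rw [hPF]
    exact ⟨i + 1, by omega, by omega, rfl⟩
  have ha0 : 0 < a := Nat.pos_of_ne_zero ha.1.2
  refine ⟨ha.1.1, hbg.1, ha.1.2, hbg.2.1, hα, hℓ, by omega, by omega, ?_, ?_, ?_, ?_⟩
  · intro x hx
    rw [hgen] at hx
    rcases hx with (rfl | rfl) | ⟨i, h2, hi, rfl⟩
    · exact .inl rfl
    · exact .inr (.inl rfl)
    · refine .inr (.inr ⟨i - 1, by omega, by omega, ?_⟩)
      rw [key, Nat.sub_add_cancel (by omega)]
  · intro i h1 hi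
    rw [hgen, key]
    exact .inr ⟨i + 1, by omega, by omega, rfl⟩
  · intro i hi
    obtain ⟨hnot, hadd⟩ := hmem i hi
    rw [key]
    constructor
    · obtain ⟨z, hz, hze⟩ := hadd a ha.1.1 ha0
      have : z = h + (i + 1) * α + a := by
        have : (z : ℤ) = ((h + (i + 1) * α + a : ℕ) : ℤ) := by push_cast at hze ⊢; exact hze
        exact_mod_cast this
      rwa [← this]
    · intro z hz hze
      refine hnot ⟨z, hz, ?_⟩
      have : z = h + (i + 1) * α := by omega
      rw [this]
      push_cast
      ring
  · intro i hi y hy hy0 hA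
    obtain ⟨z, hz, hze⟩ := (hmem i hi).2 y hy (Nat.pos_of_ne_zero hy0)
    refine hA.2 z hz ?_
    have : z = h + (i + 1) * α + y := by
      have : (z : ℤ) = ((h + (i + 1) * α + y : ℕ) : ℤ) := by push_cast at hze ⊢; exact hze
      exact_mod_cast this
    rw [key, this]
    ring

/-! ### Cohen–Macaulay criteria for rings that are a principal ideal domain modulo nilpotents -/

section Criteria

variable {G D : Type*} [CommRing G] [CommRing D]

theorem ker_le_of_isPrime {φ : G →+* D} (hnil : RingHom.ker φ ≤ nilradical G) (p : Ideal G)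
    [p.IsPrime] : RingHom.ker φ ≤ p :=
  hnil.trans (nilradical_le_prime p)

variable [IsDomain D] [IsPrincipalIdealRing D]

/-- The kernel is prime and lies in every prime, so it is the unique minimal prime; any other prime
comes from a nonzero prime of `D` and is maximal. -/
theorem height_eq_one_of_surjective {φ : G →+* D} (hφ : Function.Surjective φ)
    (hD : ¬ IsField D) (hnil : RingHom.ker φ ≤ nilradical G) (p : Ideal G) [p.IsMaximal] :
    p.height = 1 := by
  have hker : (RingHom.ker φ).IsPrime := RingHom.ker_isPrime φ
  have hlt : RingHom.ker φ < p := by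
    refine lt_of_le_of_ne (ker_le_of_isPrime hnil p) ?_
    rintro rfl
    exact hD ((RingHom.quotientKerEquivOfSurjective hφ).symm.toMulEquiv.isField
      ((Ideal.Quotient.maximal_ideal_iff_isField_quotient _).1 ‹_›))
  apply le_antisymm
  · refine (Ideal.height_le_iff (n := 1)).2 fun q hq hqp => ?_
    suffices q = RingHom.ker φ by
      subst this
      have : (RingHom.ker φ).height = 0 :=
        Ideal.height_eq_zero_iff.2 ⟨⟨hq, bot_le⟩, fun r hr _ => by
          have := hr.1
          exact ker_le_of_isPrime hnil r⟩
      rw [this]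
      simp
    by_contra hne
    have hle := ker_le_of_isPrime hnil q
    have hcomap : (q.map φ).comap φ = q := by
      rw [Ideal.comap_map_of_surjective' φ hφ, sup_eq_left.2 hle]
    have hprime : (q.map φ).IsPrime := Ideal.map_isPrime_of_surjective hφ hle
    have hbot : q.map φ ≠ ⊥ := by
      intro h
      rw [h, ← RingHom.ker_eq_comap_bot] at hcomap
      exact hne hcomap.symm
    have hmax : (q.map φ).IsMaximal := IsPrime.to_maximal_ideal hbot
    have := Ideal.comap_isMaximal_of_surjective φ hφ (K := q.map φ)
    rw [hcomap] at this
    exact hqp.ne (this.eq_of_le (Ideal.IsPrime.ne_top') hqp.le)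
  · have := Ideal.height_add_one_le_of_lt_of_isPrime hlt
    exact le_trans (by simp) this

theorem isCohenMacaulay_of_surjective [IsNoetherianRing G] {φ : G →+* D}
    (hφ : Function.Surjective φ) (hD : ¬ IsField D) (hnil : RingHom.ker φ ≤ nilradical G)
    (hlift : ∀ d : D, d ≠ 0 → ∃ g : G, (∀ y, g * y = 0 → y = 0) ∧ φ g = d) : IsCohenMacaulay G := by
  refine ⟨inferInstance, fun p hp => ⟨IsLocalization.isNoetherianRing p.primeCompl _ ‹_›, ?_⟩⟩
  have hht := height_eq_one_of_surjective hφ hD hnil p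
  obtain ⟨x, hxp, hx⟩ : ∃ x ∈ p, φ x ≠ 0 := by
    by_contra! h
    have heq : p = RingHom.ker φ := le_antisymm h (ker_le_of_isPrime hnil p)
    have : p.height = 0 := Ideal.height_eq_zero_iff.2 ⟨⟨inferInstance, bot_le⟩, fun r hr _ => by
      have := hr.1
      exact heq ▸ ker_le_of_isPrime hnil r⟩
    simp [this] at hht
  obtain ⟨g, hg, hgx⟩ := hlift _ hx
  -- `g` and `x` have the same image, and the nilpotent kernel lies in `p`.
  have hgp : g ∈ p := by
    have : g - x ∈ p := ker_le_of_isPrime hnil p (by simp [RingHom.mem_ker, hgx])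
    simpa using p.add_mem this hxp
  have hreg : RingTheory.Sequence.IsWeaklyRegular G [g] := by
    rw [RingTheory.Sequence.isWeaklyRegular_singleton_iff]
    exact Module.Flat.isSMulRegular_of_nonZeroDivisors (mem_nonZeroDivisors_iff_left.2 hg)
  refine ⟨[g].map (algebraMap G (Localization.AtPrime p)), ?_,
    hreg.isRegular_of_isLocalization_of_mem _ p (by simpa using hgp), ?_⟩
  · simpa only [List.map_cons, List.map_nil, List.mem_singleton, forall_eq,
      IsLocalization.AtPrime.to_map_mem_maximal_iff _ p] using hgp
  · rw [IsLocalization.AtPrime.ringKrullDim_eq_height p, hht]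
    simp

theorem eq_zero_of_map_mul_eq_zero {A G : Type*} [CommRing A] [CommRing G] {π : A →+* G}
    (hπ : Function.Surjective π) {x : A} (h : ∀ y, x * y ∈ RingHom.ker π → y ∈ RingHom.ker π)
    (g : G) (hg : π x * g = 0) : g = 0 := by
  obtain ⟨y, rfl⟩ := hπ g
  rw [← map_mul] at hg
  exact h y hg

theorem mem_radical_annihilator_span_singleton {G : Type*} [CommRing G] {x e : G} (n : ℕ)
    (h : x ^ n * e = 0) : x ∈ (Ideal.span {e}).annihilator.radical :=
  ⟨n, (Submodule.mem_annihilator_span_singleton _ _).2 h⟩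

/-- A regular element of the local ring at `p` has a power killing `e`, so `e` vanishes there. It
then vanishes globally, since the annihilator of `e` contains an element outside `p` and a power of
each element of `p`. -/
theorem eq_zero_of_isCohenMacaulay {G : Type*} [CommRing G] (hCM : IsCohenMacaulay G)
    (p : Ideal G) [p.IsMaximal] (hht : p.height = 1) (e : G)
    (hp : p ≤ (Ideal.span {e}).annihilator.radical) : e = 0 := by
  have he : ∀ x ∈ p, ∃ n : ℕ, x ^ n * e = 0 := fun x hx => by
    obtain ⟨n, hn⟩ := hp hx
    exact ⟨n, (Submodule.mem_annihilator_span_singleton _ _).1 hn⟩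
  obtain ⟨-, rs, hmem, hreg, hlen⟩ := hCM.2 p
  rw [IsLocalization.AtPrime.ringKrullDim_eq_height p, hht] at hlen
  obtain _ | ⟨r, rs⟩ := rs
  · simp at hlen
  have hr := ((RingTheory.Sequence.isRegular_cons_iff _ r rs).1 hreg).1
  obtain ⟨x, s, rfl⟩ := IsLocalization.exists_mk'_eq p.primeCompl r
  have hxp : x ∈ p := by
    have := hmem _ List.mem_cons_self
    rwa [IsLocalization.AtPrime.mk'_mem_maximal_iff _ p] at this
  obtain ⟨n, hn⟩ := he x hxp
  have h0 : algebraMap G (Localization.AtPrime p) e = 0 := by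
    refine (hr.pow n) ?_
    dsimp only
    rw [smul_zero, smul_eq_mul, ← IsLocalization.mk'_pow, ← IsLocalization.mk'_one
      (M := p.primeCompl) _ e, ← IsLocalization.mk'_mul, hn, IsLocalization.mk'_zero]
  obtain ⟨⟨s, hs⟩, hse⟩ := (IsLocalization.map_eq_zero_iff p.primeCompl _ e).1 h0
  obtain ⟨y, hy⟩ := Ideal.IsMaximal.exists_inv ‹_› hs
  obtain ⟨z, hz, hyz⟩ := hy
  obtain ⟨n, hn⟩ := he z hz
  have hze : z * e = e := by
    have : y * (s * e) + z * e = e := by rw [← mul_assoc, ← add_mul, hyz, one_mul]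
    rwa [show s * e = 0 from hse, mul_zero, zero_add] at this
  have : ∀ n : ℕ, z ^ n * e = e := by
    intro n
    induction n with
    | zero => simp
    | succ n ih => rw [pow_succ, mul_assoc, hze, ih]
  rw [← this n, hn]

end Criteria

/-! ### Powers of the maximal ideal of `k[H]` -/

section SemigroupRing

variable {k : Type*} [Field k] {H : AddSubmonoid ℕ}

theorem semigroupMonomial_coe {x : ℕ} (hx : x ∈ H) :
    (semigroupMonomial k H x hx : k[X]) = X ^ x := rfl

theorem semigroupMonomial_mul {x y : ℕ} (hx : x ∈ H) (hy : y ∈ H) :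
    semigroupMonomial k H x hx * semigroupMonomial k H y hy =
      semigroupMonomial k H (x + y) (H.add_mem hx hy) :=
  Subtype.ext (pow_add X x y).symm

theorem semigroupMonomial_zero : semigroupMonomial k H 0 H.zero_mem = 1 :=
  Subtype.ext (pow_zero X)

theorem mem_of_semigroupMonomial_mem (N : Submodule k (semigroupRing k H)) (f : semigroupRing k H)
    (h : ∀ x (hx : x ∈ H), (f : k[X]).coeff x ≠ 0 → semigroupMonomial k H x hx ∈ N) :
    f ∈ N := by
  have hf : f = ∑ x ∈ (f : k[X]).support.attach, (f : k[X]).coeff x.1 •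
      semigroupMonomial k H x.1 (f.2 x.1 (mem_support_iff.1 x.2)) := by
    apply Subtype.ext
    rw [AddSubmonoidClass.coe_finsetSum]
    simp only [SetLike.val_smul, semigroupMonomial_coe]
    rw [Finset.sum_attach (f : k[X]).support (fun x => (f : k[X]).coeff x • (X : k[X]) ^ x)]
    simp only [smul_eq_C_mul]
    exact (f : k[X]).as_sum_support_C_mul_X_pow
  rw [hf]
  exact N.sum_mem fun x _ => N.smul_mem _ (h _ _ (mem_support_iff.1 x.2))

theorem semigroupRing_finiteType (hfin : (minimalGenerators H).Finite) :
    Algebra.FiniteType k (semigroupRing k H) := by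
  let s : Set (semigroupRing k H) :=
    Set.range fun g : minimalGenerators H => semigroupMonomial k H g g.2.1
  have : Finite (minimalGenerators H) := hfin
  have hs : s.Finite := Set.finite_range _
  refine ⟨⟨hs.toFinset, ?_⟩⟩
  rw [hs.coe_toFinset, eq_top_iff]
  rintro f -
  refine mem_of_semigroupMonomial_mem (Subalgebra.toSubmodule (Algebra.adjoin k s)) f ?_
  intro x hx _
  have := induction_minimalGenerators (H := H) (x := 0) (z := x)
    (P := fun u => ∃ hu : u ∈ H, semigroupMonomial k H u hu ∈ Algebra.adjoin k s)
    ⟨H.zero_mem, by rw [semigroupMonomial_zero]; exact one_mem _⟩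
    (fun u ⟨hu, hu'⟩ g hg => ⟨H.add_mem hu hg.1, by
      rw [← semigroupMonomial_mul hu hg.1]
      exact mul_mem hu' (Algebra.subset_adjoin ⟨⟨g, hg⟩, rfl⟩)⟩) hx
  simp only [zero_add] at this
  exact this.2

theorem mem_semigroupMaximalIdeal {f : semigroupRing k H} :
    f ∈ semigroupMaximalIdeal k H ↔ (f : k[X]).coeff 0 = 0 := Iff.rfl

/-- The ideal of `k[H]` spanned by the `t ^ x` with `x` a sum of `m` nonzero elements of `H`. -/
def orderIdeal (k : Type*) [Field k] (H : AddSubmonoid ℕ) (m : ℕ) :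
    Ideal (semigroupRing k H) where
  carrier := {f | ∀ x, (f : k[X]).coeff x ≠ 0 → x ∈ orderSet H m}
  zero_mem' := by
    intro x hx
    simp at hx
  add_mem' := by
    intro f g hf hg x hx
    by_cases h : (f : k[X]).coeff x = 0
    · refine hg x fun h' => hx ?_
      simp [h, h']
    · exact hf x h
  smul_mem' := by
    intro c f hf x hx
    change ((c : k[X]) * (f : k[X])).coeff x ≠ 0 at hx
    rw [coeff_mul] at hx
    obtain ⟨⟨p, q⟩, hpq, hne⟩ := Finset.exists_ne_zero_of_sum_ne_zero hx
    rw [← Finset.HasAntidiagonal.mem_antidiagonal.mp hpq, add_comm]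
    exact add_mem_orderSet (hf q (right_ne_zero_of_mul hne)) (c.2 p (left_ne_zero_of_mul hne))

theorem semigroupMonomial_mem_pow {m x : ℕ} (hx : x ∈ orderSet H m) :
    semigroupMonomial k H x (orderSet_subset H m hx) ∈ semigroupMaximalIdeal k H ^ m := by
  induction m generalizing x with
  | zero => simp
  | succ m ih =>
    obtain ⟨y, hy, z, hz, hz0, rfl⟩ := hx
    rw [← semigroupMonomial_mul (orderSet_subset H m hy) hz, pow_succ]
    refine Ideal.mul_mem_mul (ih hy) ?_
    rw [mem_semigroupMaximalIdeal, semigroupMonomial_coe, coeff_X_pow, if_neg hz0.symm]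

/-- The powers are monomial ideals, so questions about `𝔪 ^ m` become questions about exponents in
`orderSet H m`. -/
theorem semigroupMaximalIdeal_pow (m : ℕ) :
    semigroupMaximalIdeal k H ^ m = orderIdeal k H m := by
  apply le_antisymm
  · induction m with
    | zero => exact fun f _ => f.2
    | succ m ih =>
      rw [pow_succ]
      refine Ideal.mul_le.2 fun f hf g hg x hx => ?_
      change ((f : k[X]) * (g : k[X])).coeff x ≠ 0 at hx
      rw [coeff_mul] at hx
      obtain ⟨⟨p, q⟩, hpq, hne⟩ := Finset.exists_ne_zero_of_sum_ne_zero hx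
      rw [← Finset.HasAntidiagonal.mem_antidiagonal.mp hpq]
      have hq := right_ne_zero_of_mul hne
      refine add_mem_orderSet_succ (ih hf p (left_ne_zero_of_mul hne)) (g.2 q hq) ?_
      rintro rfl
      exact hq hg
  · intro f hf
    exact mem_of_semigroupMonomial_mem ((semigroupMaximalIdeal k H ^ m).restrictScalars k) f
      fun x hx hne => semigroupMonomial_mem_pow (hf x hne)

theorem mem_semigroupMaximalIdeal_pow {m : ℕ} {f : semigroupRing k H} :
    f ∈ semigroupMaximalIdeal k H ^ m ↔ ∀ x, (f : k[X]).coeff x ≠ 0 → x ∈ orderSet H m := by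
  rw [semigroupMaximalIdeal_pow]
  rfl

theorem semigroupMonomial_mem_pow_iff {m x : ℕ} (hx : x ∈ H) :
    semigroupMonomial k H x hx ∈ semigroupMaximalIdeal k H ^ m ↔ x ∈ orderSet H m := by
  refine ⟨fun h => mem_semigroupMaximalIdeal_pow.1 h x ?_, semigroupMonomial_mem_pow⟩
  simp [semigroupMonomial_coe]

theorem mem_pow_of_semigroupMonomial_mul_mem {a : ℕ} (ha : a ∈ H) {m : ℕ}
    (hadd : ∀ x ∈ H, x + a ∈ orderSet H (m + 1) → x ∈ orderSet H m) {f : semigroupRing k H}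
    (hf : semigroupMonomial k H a ha * f ∈ semigroupMaximalIdeal k H ^ (m + 1)) :
    f ∈ semigroupMaximalIdeal k H ^ m := by
  rw [mem_semigroupMaximalIdeal_pow] at hf ⊢
  intro x hx
  refine hadd x (f.2 x hx) (hf (x + a) ?_)
  change ((X : k[X]) ^ a * (f : k[X])).coeff (x + a) ≠ 0
  rwa [coeff_X_pow_mul]

theorem mem_pow_of_semigroupMonomial_pow_mul_mem {a : ℕ} (ha : a ∈ H)
    (hadd : ∀ m, ∀ x ∈ H, x + a ∈ orderSet H (m + 1) → x ∈ orderSet H m) {m i : ℕ}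
    {f : semigroupRing k H}
    (hf : semigroupMonomial k H a ha ^ i * f ∈ semigroupMaximalIdeal k H ^ (m + i)) :
    f ∈ semigroupMaximalIdeal k H ^ m := by
  induction i with
  | zero => simpa using hf
  | succ i ih =>
    refine ih (mem_pow_of_semigroupMonomial_mul_mem ha (hadd _) ?_)
    rwa [← mul_assoc, ← pow_succ']

end SemigroupRing

theorem Polynomial.coeff_mul_add_of_coeff_lt {R : Type*} [CommSemiring R] {f g : R[X]} {m n : ℕ}
    (hf : ∀ i < m, f.coeff i = 0) (hg : ∀ i < n, g.coeff i = 0) :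
    (f * g).coeff (m + n) = f.coeff m * g.coeff n := by
  obtain ⟨u, rfl⟩ := X_pow_dvd_iff.2 hf
  obtain ⟨v, rfl⟩ := X_pow_dvd_iff.2 hg
  have e : X ^ m * u * (X ^ n * v) = X ^ (m + n) * (u * v) := by ring
  have h0 : ∀ (i : ℕ) (w : R[X]), (X ^ i * w).coeff i = w.coeff 0 := fun i w => by
    simpa using coeff_X_pow_mul w i 0
  rw [e, h0, h0, h0, mul_coeff_zero]

/-! ### The tangent cone and its map onto `k[X]` -/

section TangentCone

variable {k : Type*} [Field k] {H : AddSubmonoid ℕ} {a : ℕ}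

theorem coeff_eq_zero_of_mem_pow (ha : IsMultiplicity H a) {m x : ℕ} {f : semigroupRing k H}
    (hf : f ∈ semigroupMaximalIdeal k H ^ m) (hx : x < a * m) : (f : k[X]).coeff x = 0 := by
  by_contra h
  have := mul_le_of_mem_orderSet ha (mem_semigroupMaximalIdeal_pow.1 hf x h)
  omega

/-- The polynomial whose `i`-th coefficient is the coefficient of `t ^ (a * i)` in the `i`-th
coefficient of `F`. -/
noncomputable def leadingPolynomial (a : ℕ) (F : (semigroupRing k H)[X]) : k[X] :=
  ∑ i ∈ F.support, monomial i ((F.coeff i : k[X]).coeff (a * i))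

theorem coeff_leadingPolynomial (a : ℕ) (F : (semigroupRing k H)[X]) (i : ℕ) :
    (leadingPolynomial a F).coeff i = (F.coeff i : k[X]).coeff (a * i) := by
  rw [leadingPolynomial, finsetSum_coeff]
  simp only [coeff_monomial, Finset.sum_ite_eq', mem_support_iff]
  split_ifs with h
  · rfl
  · rw [notMem_support_iff.1 h]
    simp

/-- The ring homomorphism from the Rees algebra to `k[X]` which sends `t ^ (a * i) Y ^ i` to
`X ^ i` and all `t ^ x Y ^ i` with `x > a * i` to `0`. -/
noncomputable def reesLeading (k : Type*) [Field k] (ha : IsMultiplicity H a) :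
    reesAlgebra (semigroupMaximalIdeal k H) →+* k[X] where
  toFun F := leadingPolynomial a (F : (semigroupRing k H)[X])
  map_one' := by
    ext i
    rw [coeff_leadingPolynomial]
    rcases eq_or_ne i 0 with rfl | hi
    · simp
    · simp [coeff_one, hi]
  map_zero' := by
    ext i
    simp [coeff_leadingPolynomial]
  map_add' F G := by
    ext i
    simp [coeff_leadingPolynomial]
  map_mul' F G := by
    ext i
    rw [coeff_leadingPolynomial, coeff_mul]
    change (((F : (semigroupRing k H)[X]) * (G : (semigroupRing k H)[X])).coeff i : k[X]).coeff
      (a * i) = _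
    rw [coeff_mul, AddSubmonoidClass.coe_finsetSum, finsetSum_coeff]
    refine Finset.sum_congr rfl ?_
    rintro ⟨p, q⟩ hpq
    rw [← Finset.HasAntidiagonal.mem_antidiagonal.mp hpq, coeff_leadingPolynomial,
      coeff_leadingPolynomial, mul_add]
    exact coeff_mul_add_of_coeff_lt (fun x hx => coeff_eq_zero_of_mem_pow ha (F.2 p) hx)
      (fun x hx => coeff_eq_zero_of_mem_pow ha (G.2 q) hx)

theorem coeff_reesLeading (ha : IsMultiplicity H a)
    (F : reesAlgebra (semigroupMaximalIdeal k H)) (i : ℕ) :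
    (reesLeading k ha F).coeff i =
      ((F : (semigroupRing k H)[X]).coeff i : k[X]).coeff (a * i) :=
  coeff_leadingPolynomial a _ i

theorem semigroupMonomial_pow_mem {a : ℕ} (ha : IsMultiplicity H a) (i : ℕ) :
    semigroupMonomial k H a ha.1.1 ^ i ∈ semigroupMaximalIdeal k H ^ i := by
  refine Ideal.pow_mem_pow ?_ i
  rw [mem_semigroupMaximalIdeal, semigroupMonomial_coe, coeff_X_pow, if_neg ha.1.2.symm]

/-- The polynomial `d(t ^ a Y)` as an element of the Rees algebra. -/
noncomputable def reesLift (ha : IsMultiplicity H a) (d : k[X]) :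
    reesAlgebra (semigroupMaximalIdeal k H) :=
  ⟨(d.map (algebraMap k (semigroupRing k H))).comp (C (semigroupMonomial k H a ha.1.1) * X), by
    intro i
    rw [comp_C_mul_X_coeff]
    exact Ideal.mul_mem_left _ _ (semigroupMonomial_pow_mem ha i)⟩

theorem coeff_reesLift (ha : IsMultiplicity H a) (d : k[X]) (i : ℕ) :
    (reesLift ha d : (semigroupRing k H)[X]).coeff i =
      algebraMap k (semigroupRing k H) (d.coeff i) * semigroupMonomial k H a ha.1.1 ^ i := by
  change ((d.map (algebraMap k (semigroupRing k H))).comp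
    (C (semigroupMonomial k H a ha.1.1) * X)).coeff i = _
  rw [comp_C_mul_X_coeff, coeff_map]

theorem reesLeading_reesLift (ha : IsMultiplicity H a) (d : k[X]) :
    reesLeading k ha (reesLift ha d) = d := by
  ext i
  rw [coeff_reesLeading, coeff_reesLift]
  change (C (d.coeff i) * ((X : k[X]) ^ a) ^ i).coeff (a * i) = _
  rw [← pow_mul, coeff_C_mul, coeff_X_pow, if_pos rfl, mul_one]

/-- The lowest term of `d` decides. If `i` is its degree, then in degree `i + j` every other product
vanishes or is in `𝔪 ^ (i + j + 1)` by induction. Up to a unit, `(t ^ a) ^ i` times the `j`-th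
coefficient of `F` remains, and `hadd` cancels the power of `t ^ a`. -/
theorem mem_reesShiftIdeal_of_reesLift_mul_mem (ha : IsMultiplicity H a)
    (hadd : ∀ m, ∀ x ∈ H, x + a ∈ orderSet H (m + 1) → x ∈ orderSet H m) {d : k[X]}
    (hd : d ≠ 0) (F : reesAlgebra (semigroupMaximalIdeal k H))
    (hg : reesLift ha d * F ∈ reesShiftIdeal (semigroupMaximalIdeal k H)) :
    F ∈ reesShiftIdeal (semigroupMaximalIdeal k H) := by
  intro j
  induction j using Nat.strong_induction_on with
  | _ j ih =>
    set i := d.natTrailingDegree with hi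
    have h := hg (i + j)
    change ((reesLift ha d : (semigroupRing k H)[X]) * (F : (semigroupRing k H)[X])).coeff (i + j)
      ∈ _ at h
    rw [coeff_mul, ← Finset.add_sum_erase _ _
      ((Finset.HasAntidiagonal.mem_antidiagonal (a := (i, j))).2 rfl)] at h
    have hrest : ∑ x ∈ (Finset.HasAntidiagonal.antidiagonal (i + j)).erase (i, j),
        (reesLift ha d : (semigroupRing k H)[X]).coeff x.1 *
          (F : (semigroupRing k H)[X]).coeff x.2 ∈
        semigroupMaximalIdeal k H ^ (i + j + 1) := by
      refine Ideal.sum_mem _ ?_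
      rintro ⟨p, q⟩ hpq
      obtain ⟨hne, hpq⟩ := Finset.mem_erase.1 hpq
      have hs : p + q = i + j := Finset.HasAntidiagonal.mem_antidiagonal.1 hpq
      rcases lt_trichotomy p i with hp | hp | hp
      · rw [coeff_reesLift, coeff_eq_zero_of_lt_natTrailingDegree hp]
        simp
      · exact absurd (Prod.ext hp (show q = j by omega)) hne
      · have := Ideal.mul_mem_mul ((reesLift ha d).2 p) (ih q (by omega))
        rwa [← pow_add, ← add_assoc, hs] at this
    have h1 := (Ideal.add_mem_iff_left _ hrest).1 h
    dsimp only at h1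
    rw [coeff_reesLift] at h1
    have hu : IsUnit (algebraMap k (semigroupRing k H) (d.coeff i)) :=
      (IsUnit.mk0 _ (by simpa [hi, ← trailingCoeff.eq_1] using hd)).map _
    rw [mul_assoc, Ideal.unit_mul_mem_iff_mem _ hu] at h1
    refine mem_pow_of_semigroupMonomial_pow_mul_mem ha.1.1 hadd (i := i) ?_
    convert h1 using 2
    omega

variable {G : Type*} [CommRing G] {π : reesAlgebra (semigroupMaximalIdeal k H) →+* G}

/-- Given a surjection `π` from the Rees algebra to the tangent cone, the ring homomorphism from
the tangent cone to `k[X]` which sends the initial form of `t ^ a` to `X` and the initial forms of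
all `t ^ x` with `x > a * i`, `i` the order of `x`, to `0`. -/
noncomputable def tangentConeLeading (ha : IsMultiplicity H a) (hπ : Function.Surjective π)
    (hker : RingHom.ker π = reesShiftIdeal (semigroupMaximalIdeal k H)) : G →+* k[X] :=
  π.liftOfSurjective hπ ⟨reesLeading k ha, fun F hF => by
    rw [hker] at hF
    ext i
    rw [coeff_reesLeading, coeff_zero]
    refine coeff_eq_zero_of_mem_pow ha (hF i) ?_
    have := Nat.pos_of_ne_zero ha.1.2
    rw [mul_add, mul_one]
    omega⟩

theorem tangentConeLeading_map (ha : IsMultiplicity H a) (hπ : Function.Surjective π)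
    (hker : RingHom.ker π = reesShiftIdeal (semigroupMaximalIdeal k H))
    (F : reesAlgebra (semigroupMaximalIdeal k H)) :
    tangentConeLeading ha hπ hker (π F) = reesLeading k ha F :=
  π.liftOfRightInverse_comp_apply _ _ _ F

theorem tangentConeLeading_surjective (ha : IsMultiplicity H a) (hπ : Function.Surjective π)
    (hker : RingHom.ker π = reesShiftIdeal (semigroupMaximalIdeal k H)) :
    Function.Surjective (tangentConeLeading ha hπ hker) := fun d =>
  ⟨π (reesLift ha d), by rw [tangentConeLeading_map, reesLeading_reesLift]⟩

/-- The class of `t ^ x` in `𝔪 ^ i / 𝔪 ^ (i + 1)`. -/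
noncomputable def tangentMonomial (π : reesAlgebra (semigroupMaximalIdeal k H) →+* G) (i x : ℕ)
    (hx : x ∈ orderSet H i) : G :=
  π ⟨monomial i (semigroupMonomial k H x (orderSet_subset H i hx)),
    reesAlgebra.monomial_mem.2 (semigroupMonomial_mem_pow hx)⟩

theorem tangentMonomial_mul {i j x y : ℕ} (hx : x ∈ orderSet H i) (hy : y ∈ orderSet H j) :
    tangentMonomial π i x hx * tangentMonomial π j y hy =
      tangentMonomial π (i + j) (x + y) (add_mem_orderSet_add hx hy) := by
  rw [tangentMonomial, tangentMonomial, ← map_mul]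
  congr 1
  apply Subtype.ext
  change monomial i _ * monomial j _ = monomial (i + j) _
  rw [monomial_mul_monomial, semigroupMonomial_mul]

theorem zero_mem_orderSet (H : AddSubmonoid ℕ) : 0 ∈ orderSet H 0 := H.zero_mem

theorem tangentMonomial_zero : tangentMonomial π 0 0 (zero_mem_orderSet H) = 1 := by
  rw [tangentMonomial, ← map_one π]
  congr 1

theorem nsmul_mem_orderSet {i x : ℕ} (hx : x ∈ orderSet H i) (n : ℕ) :
    n * x ∈ orderSet H (n * i) := by
  induction n with
  | zero => simpa using zero_mem_orderSet H
  | succ n ih =>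
    rw [add_mul, add_mul, one_mul, one_mul]
    exact add_mem_orderSet_add ih hx

theorem tangentMonomial_congr {i j x y : ℕ} (hx : x ∈ orderSet H i) (hij : i = j) (hxy : x = y) :
    tangentMonomial π i x hx = tangentMonomial π j y (hij ▸ hxy ▸ hx) := by
  subst hij hxy
  rfl

theorem tangentMonomial_pow {i x : ℕ} (hx : x ∈ orderSet H i) (n : ℕ) :
    tangentMonomial π i x hx ^ n =
      tangentMonomial π (n * i) (n * x) (nsmul_mem_orderSet hx n) := by
  induction n with
  | zero =>
    rw [pow_zero, ← tangentMonomial_zero (π := π)]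
    exact tangentMonomial_congr (zero_mem_orderSet H) (by simp) (by simp)
  | succ n ih =>
    rw [pow_succ, ih, tangentMonomial_mul]
    exact tangentMonomial_congr _ (by ring) (by ring)

theorem tangentMonomial_eq_zero_iff
    (hker : RingHom.ker π = reesShiftIdeal (semigroupMaximalIdeal k H)) {i x : ℕ}
    (hx : x ∈ orderSet H i) :
    tangentMonomial π i x hx = 0 ↔ x ∈ orderSet H (i + 1) := by
  rw [tangentMonomial, ← RingHom.mem_ker, hker,
    ← semigroupMonomial_mem_pow_iff (k := k) (orderSet_subset H i hx)]
  constructor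
  · intro h
    simpa using h i
  · intro h j
    change (monomial i (semigroupMonomial k H x (orderSet_subset H i hx))).coeff j ∈ _
    rw [coeff_monomial]
    split_ifs with hij
    · subst hij
      exact h
    · exact Ideal.zero_mem _

theorem mk_mem_of_tangentMonomial_mem (J : Ideal G)
    (F : reesAlgebra (semigroupMaximalIdeal k H))
    (h : ∀ i x (hx : x ∈ orderSet H i),
      ((F : (semigroupRing k H)[X]).coeff i : k[X]).coeff x ≠ 0 → tangentMonomial π i x hx ∈ J) :
    π F ∈ J := by
  -- `N i` collects the `r` in `𝔪 ^ i` whose class in degree `i` lies in `J`; as a `k`-subspace it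
  -- can be tested on monomials.
  let N (i : ℕ) : Submodule (semigroupRing k H) (semigroupRing k H) :=
    { carrier := {r | ∃ hr : r ∈ semigroupMaximalIdeal k H ^ i,
        π (⟨monomial i r, reesAlgebra.monomial_mem.2 hr⟩ :
          reesAlgebra (semigroupMaximalIdeal k H)) ∈ J}
      zero_mem' := ⟨Ideal.zero_mem _, by
        convert J.zero_mem using 1
        rw [← map_zero π]
        congr 1
        exact Subtype.ext (monomial_zero_right i)⟩
      add_mem' := by
        rintro r s ⟨hr, hr'⟩ ⟨hs, hs'⟩
        refine ⟨Ideal.add_mem _ hr hs, ?_⟩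
        convert J.add_mem hr' hs' using 1
        rw [← map_add]
        congr 1
        exact Subtype.ext (map_add (monomial i) r s)
      smul_mem' := by
        rintro c r ⟨hr, hr'⟩
        refine ⟨Ideal.mul_mem_left _ c hr, ?_⟩
        convert J.mul_mem_left (π (algebraMap _ _ c)) hr' using 1
        rw [← map_mul]
        congr 1
        apply Subtype.ext
        change monomial i (c * r) = C c * monomial i r
        rw [C_mul_monomial] }
  have key : ∀ i, (F : (semigroupRing k H)[X]).coeff i ∈ N i := fun i => by
    refine mem_of_semigroupMonomial_mem ((N i).restrictScalars k) _ fun x _ hne => ?_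
    have hx := mem_semigroupMaximalIdeal_pow.1 (F.2 i) x hne
    exact ⟨semigroupMonomial_mem_pow hx, h i x hx hne⟩
  have hF : F = ∑ i ∈ (F : (semigroupRing k H)[X]).support,
      (⟨monomial i ((F : (semigroupRing k H)[X]).coeff i), reesAlgebra.monomial_mem.2 (F.2 i)⟩ :
        reesAlgebra (semigroupMaximalIdeal k H)) := by
    apply Subtype.ext
    rw [AddSubmonoidClass.coe_finsetSum]
    exact (F : (semigroupRing k H)[X]).as_sum_support
  rw [hF, map_sum]
  exact J.sum_mem fun i _ => (key i).2

/-- The `a`-th power has exponent `a * x`, a sum of `x` copies of `a`; its order is at least `x`,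
which exceeds the degree `a * i`. -/
theorem isNilpotent_tangentMonomial
    (hker : RingHom.ker π = reesShiftIdeal (semigroupMaximalIdeal k H))
    (ha : IsMultiplicity H a) {i x : ℕ} (hx : x ∈ orderSet H i)
    (hne : x ≠ a * i) : IsNilpotent (tangentMonomial π i x hx) := by
  refine ⟨a, ?_⟩
  rw [tangentMonomial_pow, tangentMonomial_eq_zero_iff hker, mul_comm a x]
  have hle := mul_le_of_mem_orderSet ha hx
  exact orderSet_antitone H (show a * i + 1 ≤ x by omega) (mul_mem_orderSet ha.1.1 ha.1.2 x)

theorem ker_tangentConeLeading_le (ha : IsMultiplicity H a) (hπ : Function.Surjective π)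
    (hker : RingHom.ker π = reesShiftIdeal (semigroupMaximalIdeal k H)) :
    RingHom.ker (tangentConeLeading ha hπ hker) ≤ nilradical G := by
  intro g hg
  obtain ⟨F, rfl⟩ := hπ g
  refine mk_mem_of_tangentMonomial_mem _ F fun i x hx hne => ?_
  refine mem_nilradical.2 (isNilpotent_tangentMonomial hker ha hx ?_)
  rintro rfl
  apply hne
  rw [← coeff_reesLeading ha, ← tangentConeLeading_map ha hπ hker, RingHom.mem_ker.1 hg,
    coeff_zero]

theorem isCohenMacaulay_of_orderSet (hπ : Function.Surjective π)
    (hker : RingHom.ker π = reesShiftIdeal (semigroupMaximalIdeal k H))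
    (ha : IsMultiplicity H a)
    (hfin : (minimalGenerators H).Finite)
    (hadd : ∀ m, ∀ x ∈ H, x + a ∈ orderSet H (m + 1) → x ∈ orderSet H m) :
    IsCohenMacaulay G := by
  have := semigroupRing_finiteType (k := k) hfin
  have : IsNoetherianRing (semigroupRing k H) := Algebra.FiniteType.isNoetherianRing k _
  have : IsNoetherianRing G := isNoetherianRing_of_surjective _ _ π hπ
  exact isCohenMacaulay_of_surjective (tangentConeLeading_surjective ha hπ hker)
    (Polynomial.not_isField k) (ker_tangentConeLeading_le ha hπ hker) fun d hd =>
      ⟨π (reesLift ha d), eq_zero_of_map_mul_eq_zero hπ (by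
        rw [hker]
        exact mem_reesShiftIdeal_of_reesLift_mul_mem ha hadd hd),
        by rw [tangentConeLeading_map, reesLeading_reesLift]⟩

/-- The relation `hcq` says that the form of `t ^ a`, raised to the power `q`, kills the class of `t
^ c`. Every monomial of `F` is either nilpotent or a positive power of that form, as `hF` excludes a
constant term. -/
theorem mem_radical_annihilator_tangentMonomial
    (hker : RingHom.ker π = reesShiftIdeal (semigroupMaximalIdeal k H))
    (ha : IsMultiplicity H a) {c q : ℕ}
    (hc : c ∈ orderSet H 1) (hcq : c + q * a ∈ orderSet H (q + 2))
    (F : reesAlgebra (semigroupMaximalIdeal k H)) (hF : X ∣ reesLeading k ha F) :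
    π F ∈ (Ideal.span {tangentMonomial π 1 c hc}).annihilator.radical := by
  have ha1 : a ∈ orderSet H 1 := by simpa using mul_mem_orderSet ha.1.1 ha.1.2 1
  have hT : tangentMonomial π 1 a ha1 ^ q * tangentMonomial π 1 c hc = 0 := by
    rw [tangentMonomial_pow, tangentMonomial_mul, tangentMonomial_eq_zero_iff hker, mul_one,
      add_comm _ c]
    exact hcq
  refine mk_mem_of_tangentMonomial_mem _ F fun i x hx hne => ?_
  by_cases hxi : x = a * i
  · rcases Nat.eq_zero_or_pos i with rfl | hi
    · exfalso
      apply hne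
      subst hxi
      rw [← coeff_reesLeading ha]
      exact X_dvd_iff.1 hF
    · have hpow : tangentMonomial π i x hx = tangentMonomial π 1 a ha1 ^ i := by
        rw [tangentMonomial_pow]
        exact tangentMonomial_congr _ (by simp) (by rw [hxi, mul_comm])
      rw [hpow]
      exact Ideal.pow_mem_of_mem _ (mem_radical_annihilator_span_singleton q hT) i hi
  · obtain ⟨n, hn⟩ := isNilpotent_tangentMonomial hker ha hx hxi
    exact mem_radical_annihilator_span_singleton n (by rw [hn, zero_mul])

theorem not_isCohenMacaulay_of_mem_orderSet (hπ : Function.Surjective π)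
    (hker : RingHom.ker π = reesShiftIdeal (semigroupMaximalIdeal k H))
    (ha : IsMultiplicity H a) {c q : ℕ}
    (hc : c ∈ minimalGenerators H) (hcq : c + q * a ∈ orderSet H (q + 2)) :
    ¬ IsCohenMacaulay G := by
  intro hCM
  have hc1 : c ∈ orderSet H 1 := by simpa using mul_mem_orderSet hc.1 hc.2.1 1
  have he : tangentMonomial π 1 c hc1 ≠ 0 := fun h =>
    not_mem_orderSet_two hc ((tangentMonomial_eq_zero_iff hker hc1).1 h)
  have hX : (Ideal.span {(X : k[X])}).IsMaximal :=
    PrincipalIdealRing.isMaximal_of_irreducible irreducible_X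
  have hp : ((Ideal.span {(X : k[X])}).comap (tangentConeLeading ha hπ hker)).IsMaximal :=
    Ideal.comap_isMaximal_of_surjective _ (tangentConeLeading_surjective ha hπ hker)
  refine he (eq_zero_of_isCohenMacaulay hCM _ (height_eq_one_of_surjective
    (tangentConeLeading_surjective ha hπ hker) (Polynomial.not_isField k)
    (ker_tangentConeLeading_le ha hπ hker)
    ((Ideal.span {(X : k[X])}).comap (tangentConeLeading ha hπ hker))) _ ?_)
  intro g hg
  obtain ⟨F, rfl⟩ := hπ g
  rw [Ideal.mem_comap, tangentConeLeading_map, Ideal.mem_span_singleton] at hg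
  exact mem_radical_annihilator_tangentMonomial hker ha hc1 hcq F hg

end TangentCone

/-! ### The main theorem -/

theorem theorem4p1 (k : Type*) [Field k] (H : AddSubmonoid ℕ) (hH : IsNumericalSemigroup H)
    (n a ℓ h α b : ℕ) (hn : 3 ≤ n) (hℓ : 2 ≤ ℓ) (hα : 0 < α)
    (ha : IsMultiplicity H a) (hdim : embeddingDimension H = n) (haℓ : a + 1 = ℓ + n)
    (hstr : IsStretchedArtinianLocal
      (semigroupRing k H ⧸ Ideal.span {semigroupMonomial k H a ha.1.1}))
    (hPF : pseudoFrobenius H =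
      {x : ℤ | ∃ i : ℕ, 1 ≤ i ∧ i ≤ n - 1 ∧ x = (h : ℤ) + (i : ℤ) * (α : ℤ)})
    (hb : ℓ * b = h + α + a)
    (hgen : minimalGenerators H =
      {a, b} ∪ {x : ℕ | ∃ i : ℕ, 2 ≤ i ∧ i ≤ n - 1 ∧ x = h + i * α + a}) :
    ∃ h₁ : ℕ, h = h₁ * a + (ℓ - 1) * b ∧
      (IsCohenMacaulay (TangentCone k H) ↔ ℓ ≤ h₁ + 1) := by
  have S := isArithmeticStretched_of_pseudoFrobenius hn hℓ hα ha haℓ hPF hb hgen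
  obtain ⟨q, hq, hbq⟩ := S.exists_b_eq
  obtain ⟨h₁, rfl⟩ := Nat.exists_eq_add_of_le' hq
  have hfin : (minimalGenerators H).Finite :=
    Set.finite_of_ncard_pos (by rw [← embeddingDimension, hdim]; omega)
  have hℓb : ℓ * b = (ℓ - 1) * b + b := by
    rw [← Nat.succ_mul, Nat.succ_eq_add_one, Nat.sub_add_cancel (by omega)]
  refine ⟨h₁, ?_, fun hCM => ?_, fun hle =>
    isCohenMacaulay_of_orderSet Ideal.Quotient.mk_surjective Ideal.mk_ker ha hfin
      fun m x => S.mem_orderSet_of_add_mem hbq hle⟩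
  · rw [add_mul, one_mul] at hbq
    omega
  · by_contra! hlt
    -- The sum equals `(ℓ + 1) * b`, of order at least `ℓ + 1`, and `ℓ + 1 ≥ h₁ + 3` because `h₁ + 1
    -- < ℓ`.
    have hmem : ℓ * b + 1 * α + (h₁ + 1) * a ∈ orderSet H (h₁ + 1 + 2) := by
      have e : ℓ * b + 1 * α + (h₁ + 1) * a = (ℓ + 1) * b := by
        rw [add_mul ℓ, one_mul, one_mul]
        omega
      rw [e]
      exact orderSet_antitone H (by omega) (mul_mem_orderSet S.b_mem S.b_ne_zero (ℓ + 1))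
    exact absurd hCM (not_isCohenMacaulay_of_mem_orderSet Ideal.Quotient.mk_surjective
      Ideal.mk_ker ha (S.min_gen 1 le_rfl S.r_pos) hmem)
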